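/- Let $n>2$ and let $M$ be a non-empty smooth $n$-dimensional manifold with an $(\varepsilon)$-para Sasakian structure $(\varphi,\xi,\eta,g,\varepsilon)$. That is: $\varphi$ is a smooth $(1,1)$-tensor field, $\xi$ a smooth vector field, $\eta$ a smooth $1$-form, $g$ a pseudo-Riemannian metric, $\varepsilon\in\{1,-1\}$, and $$\varphi^2=I-\eta\otimes\xi,\quad \eta(\xi)=1,\quad \varphi\xi=0,\quad \eta\circ\varphi=0,\quad g(\varphi X,\varphi Y)=g(X,Y)-\varepsilon\,\eta(X)\eta(Y),$$ $$(\nabla_X\varphi)Y=-g(\varphi X,\varphi Y)\xi-\varepsilon\,\eta(Y)\varphi^2X$$ for all vector fields $X,Y$, where $\nabla$ is the Levi-Civita connection of $g$. The structure is called spacelike if $\varepsilon=1$ and timelike if $\varepsilon=-1$. Let $S$ be the Ricci tensor of $g$, $S(Y,Z)=\operatorname{tr}(X\mapsto R(X,Y)Z)$ with $R(X,Y)Z=\nabla_X\nabla_YZ-\nabla_Y\nabla_XZ-\nabla_{[X,Y]}Z$, and let $Q$ be the Ricci operator, $g(QX,Y)=S(X,Y)$. Suppose that $(\xi,\lambda,\mu)$,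 with real constants $\lambda,\mu$, is a gradient $\eta$-Ricci soliton: there is a smooth function $f$ with $\xi=\operatorname{grad} f$ and $$\operatorname{Hess}(f)+S+\lambda g+\mu\,\eta\otimes\eta=0,\qquad \operatorname{Hess}(f)(X,Y)=g(\nabla_X\xi,Y).$$ Suppose moreover that $Q$ is Codazzi: $(\nabla_XQ)Y=(\nabla_YQ)X$ for all vector fields $X,Y$. Then $$\mu\,\varphi X=\varphi^2X\quad\text{for all vector fields } X,\qquad \mu^2=1,\qquad (\lambda,\mu)\in\{(\varepsilon n,-1),\ (\varepsilon(n-2),1)\}.$$ Consequently the soliton is expanding ($\lambda>0$) if $M$ is spacelike and shrinking ($\lambda<0$) if $M$ is timelike. -/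

import Mathlib

open Bundle
open scoped Manifold ContDiff

/-- A smooth pseudo-Riemannian metric on an `n`-dimensional manifold: a smooth symmetric
nondegenerate `(0,2)`-tensor field (of arbitrary signature). -/
structure PseudoRiemannianMetric (n : ℕ) (M : Type*) [TopologicalSpace M]
    [ChartedSpace (EuclideanSpace ℝ (Fin n)) M] [IsManifold (𝓡 n) ∞ M] where
  /-- The bilinear form on each tangent space. -/
  val : ∀ x : M, TangentSpace (𝓡 n) x →L[ℝ] TangentSpace (𝓡 n) x →L[ℝ] ℝ
  symm : ∀ (x : M) (u v : TangentSpace (𝓡 n) x), val x u v = val x v u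
  nondegenerate : ∀ (x : M) (u : TangentSpace (𝓡 n) x), (∀ v, val x u v = 0) → u = 0
  contMDiff : ContMDiff (𝓡 n)
    ((𝓡 n).prod 𝓘(ℝ, EuclideanSpace ℝ (Fin n) →L[ℝ] EuclideanSpace ℝ (Fin n) →L[ℝ] ℝ)) ∞
    (fun x ↦ TotalSpace.mk'
      (EuclideanSpace ℝ (Fin n) →L[ℝ] EuclideanSpace ℝ (Fin n) →L[ℝ] ℝ)
      (E := fun x : M ↦ TangentSpace (𝓡 n) x →L[ℝ] TangentSpace (𝓡 n) x →L[ℝ] ℝ) x (val x))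

/-- An `(ε)`-almost paracontact metric structure `(φ, ξ, η, g, ε)` on an `n`-dimensional
manifold. -/
structure EpsAlmostParacontactMetricStructure (n : ℕ) (M : Type*) [TopologicalSpace M]
    [ChartedSpace (EuclideanSpace ℝ (Fin n)) M] [IsManifold (𝓡 n) ∞ M] where
  /-- The `(1,1)`-tensor field. -/
  φ : ∀ x : M, TangentSpace (𝓡 n) x →L[ℝ] TangentSpace (𝓡 n) x
  /-- The structure vector field. -/
  ξ : ∀ x : M, TangentSpace (𝓡 n) x
  /-- The structure `1`-form. -/
  η : ∀ x : M, TangentSpace (𝓡 n) x →L[ℝ] ℝ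
  /-- The pseudo-Riemannian metric. -/
  g : PseudoRiemannianMetric n M
  /-- The sign. -/
  ε : ℝ
  contMDiff_φ : ContMDiff (𝓡 n)
    ((𝓡 n).prod 𝓘(ℝ, EuclideanSpace ℝ (Fin n) →L[ℝ] EuclideanSpace ℝ (Fin n))) ∞
    (fun x ↦ TotalSpace.mk' (EuclideanSpace ℝ (Fin n) →L[ℝ] EuclideanSpace ℝ (Fin n))
      (E := fun x : M ↦ TangentSpace (𝓡 n) x →L[ℝ] TangentSpace (𝓡 n) x) x (φ x))
  contMDiff_ξ : ContMDiff (𝓡 n) ((𝓡 n).prod 𝓘(ℝ, EuclideanSpace ℝ (Fin n))) ∞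
    (fun x ↦ TotalSpace.mk' (EuclideanSpace ℝ (Fin n))
      (E := fun x : M ↦ TangentSpace (𝓡 n) x) x (ξ x))
  contMDiff_η : ContMDiff (𝓡 n) ((𝓡 n).prod 𝓘(ℝ, EuclideanSpace ℝ (Fin n) →L[ℝ] ℝ)) ∞
    (fun x ↦ TotalSpace.mk' (EuclideanSpace ℝ (Fin n) →L[ℝ] ℝ)
      (E := fun x : M ↦ TangentSpace (𝓡 n) x →L[ℝ] ℝ) x (η x))
  ε_eq : ε = 1 ∨ ε = -1
  φ_sq : ∀ (x : M) (u : TangentSpace (𝓡 n) x), φ x (φ x u) = u - η x u • ξ x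
  η_ξ : ∀ x : M, η x (ξ x) = 1
  φ_ξ : ∀ x : M, φ x (ξ x) = 0
  η_φ : ∀ (x : M) (u : TangentSpace (𝓡 n) x), η x (φ x u) = 0
  g_φ_φ : ∀ (x : M) (u v : TangentSpace (𝓡 n) x),
    g.val x (φ x u) (φ x v) = g.val x u v - ε * η x u * η x v

section Geometry

variable {n : ℕ} {M : Type*} [TopologicalSpace M]
  [ChartedSpace (EuclideanSpace ℝ (Fin n)) M] [IsManifold (𝓡 n) ∞ M]

/-- The vector field `Y` is smooth at `x`. -/
abbrev VectorFieldCMDiffAt (Y : ∀ y : M, TangentSpace (𝓡 n) y) (x : M) : Prop :=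
  ContMDiffAt (𝓡 n) ((𝓡 n).prod 𝓘(ℝ, EuclideanSpace ℝ (Fin n))) ∞
    (fun y ↦ TotalSpace.mk' (EuclideanSpace ℝ (Fin n))
      (E := fun y : M ↦ TangentSpace (𝓡 n) y) y (Y y)) x

/-- The vector field `Y` is differentiable at `x`. -/
abbrev VectorFieldMDiffAt (Y : ∀ y : M, TangentSpace (𝓡 n) y) (x : M) : Prop :=
  MDifferentiableAt (𝓡 n) ((𝓡 n).prod 𝓘(ℝ, EuclideanSpace ℝ (Fin n)))
    (fun y ↦ TotalSpace.mk' (EuclideanSpace ℝ (Fin n))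
      (E := fun y : M ↦ TangentSpace (𝓡 n) y) y (Y y)) x

/-- `nabla` is the Levi-Civita connection `∇` of `g`: a smooth affine connection that is compatible
with `g` and torsion-free. Mathlib's order of arguments is `nabla Y x u` for `∇_u Y` at `x`. -/
structure IsLeviCivita (g : PseudoRiemannianMetric n M)
    (nabla : CovariantDerivative (𝓡 n) (EuclideanSpace ℝ (Fin n))
      (TangentSpace (𝓡 n) : M → Type _)) : Prop where
  smooth : ∀ (x : M) (Y : ∀ y : M, TangentSpace (𝓡 n) y), VectorFieldCMDiffAt Y x →
    ContMDiffAt (𝓡 n)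
      ((𝓡 n).prod 𝓘(ℝ, EuclideanSpace ℝ (Fin n) →L[ℝ] EuclideanSpace ℝ (Fin n))) ∞
      (fun y ↦ TotalSpace.mk' (EuclideanSpace ℝ (Fin n) →L[ℝ] EuclideanSpace ℝ (Fin n))
        (E := fun y : M ↦ TangentSpace (𝓡 n) y →L[ℝ] TangentSpace (𝓡 n) y) y (nabla Y y)) x
  metric : ∀ (x : M) (Y Z : ∀ y : M, TangentSpace (𝓡 n) y),
    VectorFieldMDiffAt Y x → VectorFieldMDiffAt Z x → ∀ u : TangentSpace (𝓡 n) x,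
      mvfderiv (𝓡 n) (fun y ↦ g.val y (Y y) (Z y)) x u =
        g.val x (nabla Y x u) (Z x) + g.val x (Y x) (nabla Z x u)
  torsion_free : ∀ (x : M) (X Y : ∀ y : M, TangentSpace (𝓡 n) y),
    VectorFieldMDiffAt X x → VectorFieldMDiffAt Y x →
      nabla Y x (X x) - nabla X x (Y x) = VectorField.mlieBracket (𝓡 n) X Y x

/-- The covariant derivative `(∇_u A) v = ∇_u (A V) - A (∇_u V)` of a `(1,1)`-tensor field `A`,
where `V` is a vector field with `V x = v`, smooth near `x`. The value does not depend on the
extension `V` of `v`, see `covDerivEnd_apply`. -/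
noncomputable def covDerivEnd
    (nabla : CovariantDerivative (𝓡 n) (EuclideanSpace ℝ (Fin n))
      (TangentSpace (𝓡 n) : M → Type _))
    (A : ∀ x : M, TangentSpace (𝓡 n) x →L[ℝ] TangentSpace (𝓡 n) x) (x : M)
    (u v : TangentSpace (𝓡 n) x) : TangentSpace (𝓡 n) x :=
  nabla (fun y ↦ A y (FiberBundle.extend (EuclideanSpace ℝ (Fin n)) v y)) x u -
    A x (nabla (FiberBundle.extend (EuclideanSpace ℝ (Fin n)) v) x u)

theorem covDerivEnd_apply
    (nabla : CovariantDerivative (𝓡 n) (EuclideanSpace ℝ (Fin n))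
      (TangentSpace (𝓡 n) : M → Type _))
    (A : ∀ x : M, TangentSpace (𝓡 n) x →L[ℝ] TangentSpace (𝓡 n) x) (x : M)
    (hA : MDifferentiableAt (𝓡 n)
      ((𝓡 n).prod 𝓘(ℝ, EuclideanSpace ℝ (Fin n) →L[ℝ] EuclideanSpace ℝ (Fin n)))
      (fun y ↦ TotalSpace.mk' (EuclideanSpace ℝ (Fin n) →L[ℝ] EuclideanSpace ℝ (Fin n))
        (E := fun y : M ↦ TangentSpace (𝓡 n) y →L[ℝ] TangentSpace (𝓡 n) y) y (A y)) x)
    (u : TangentSpace (𝓡 n) x) (V : ∀ y : M, TangentSpace (𝓡 n) y) (hV : VectorFieldMDiffAt V x) :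
    covDerivEnd nabla A x u (V x) = nabla (fun y ↦ A y (V y)) x u - A x (nabla V x u) := by
  have : IsManifold (𝓡 n) 1 M := IsManifold.of_le (n := ∞) (by simp)
  have key : ∀ W : ∀ y : M, TangentSpace (𝓡 n) y, VectorFieldMDiffAt W x →
      VectorFieldMDiffAt (fun y ↦ A y (W y)) x := fun W hW ↦ hA.clm_bundle_apply hW
  have hT : TensorialAt (𝓡 n) (EuclideanSpace ℝ (Fin n))
      (fun W : ∀ y : M, TangentSpace (𝓡 n) y ↦
        nabla (fun y ↦ A y (W y)) x u - A x (nabla W x u)) x := by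
    constructor
    · intro f W hf hW
      have e : (fun y ↦ A y ((f • W) y)) = f • (fun y ↦ A y (W y)) := by
        funext y
        simp
      simp only [e, nabla.isCovariantDerivativeOnUniv.leibniz hW hf,
        nabla.isCovariantDerivativeOnUniv.leibniz (key W hW) hf]
      simp [smul_sub]
    · intro W W' hW hW'
      have e : (fun y ↦ A y ((W + W') y)) = (fun y ↦ A y (W y)) + (fun y ↦ A y (W' y)) := by
        funext y
        simp
      simp only [e, nabla.isCovariantDerivativeOnUniv.add hW hW',
        nabla.isCovariantDerivativeOnUniv.add (key W hW) (key W' hW')]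
      simp
      abel
  exact hT.pointwise (FiberBundle.mdifferentiableAt_extend ..) hV (by simp)

/-- The curvature `R(X, Y) Z = ∇_X ∇_Y Z - ∇_Y ∇_X Z - ∇_{[X, Y]} Z` of vector fields. -/
noncomputable def curvature
    (nabla : CovariantDerivative (𝓡 n) (EuclideanSpace ℝ (Fin n))
      (TangentSpace (𝓡 n) : M → Type _))
    (X Y Z : ∀ y : M, TangentSpace (𝓡 n) y) (x : M) : TangentSpace (𝓡 n) x :=
  nabla (fun y ↦ nabla Z y (Y y)) x (X x) - nabla (fun y ↦ nabla Z y (X y)) x (Y x) -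
    nabla Z x (VectorField.mlieBracket (𝓡 n) X Y x)

/-- The Riemann curvature tensor `R(u, v) w` on tangent vectors at `x`: the curvature of vector
fields that extend `u`, `v`, `w` smoothly near `x`. -/
noncomputable def curvatureTensor
    (nabla : CovariantDerivative (𝓡 n) (EuclideanSpace ℝ (Fin n))
      (TangentSpace (𝓡 n) : M → Type _))
    (x : M) (u v w : TangentSpace (𝓡 n) x) : TangentSpace (𝓡 n) x :=
  curvature nabla (FiberBundle.extend (EuclideanSpace ℝ (Fin n)) u)
    (FiberBundle.extend (EuclideanSpace ℝ (Fin n)) v)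
    (FiberBundle.extend (EuclideanSpace ℝ (Fin n)) w) x

/-- The standard basis of the model space, as a basis of the tangent space at `x`. -/
noncomputable def tangentBasis (x : M) : Module.Basis (Fin n) ℝ (TangentSpace (𝓡 n) x) :=
  (EuclideanSpace.basisFun (Fin n) ℝ).toBasis

/-- The Ricci tensor `S(v, w)`: the trace of `u ↦ R(u, v) w`, computed in a basis. -/
noncomputable def ricci
    (nabla : CovariantDerivative (𝓡 n) (EuclideanSpace ℝ (Fin n))
      (TangentSpace (𝓡 n) : M → Type _))
    (x : M) (v w : TangentSpace (𝓡 n) x) : ℝ :=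
  ∑ i, (tangentBasis x).coord i (curvatureTensor nabla x (tangentBasis x i) v w)

/-- `Q` is the Ricci operator: `g(Qu, v) = S(u, v)`. -/
def IsRicciOperator (g : PseudoRiemannianMetric n M)
    (nabla : CovariantDerivative (𝓡 n) (EuclideanSpace ℝ (Fin n))
      (TangentSpace (𝓡 n) : M → Type _))
    (Q : ∀ x : M, TangentSpace (𝓡 n) x →L[ℝ] TangentSpace (𝓡 n) x) : Prop :=
  ∀ (x : M) (u v : TangentSpace (𝓡 n) x), g.val x (Q x u) v = ricci nabla x u v

/-- A `(1,1)`-tensor field `A` is Codazzi: `(∇_u A) v = (∇_v A) u`. -/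
def IsCodazzi
    (nabla : CovariantDerivative (𝓡 n) (EuclideanSpace ℝ (Fin n))
      (TangentSpace (𝓡 n) : M → Type _))
    (A : ∀ x : M, TangentSpace (𝓡 n) x →L[ℝ] TangentSpace (𝓡 n) x) : Prop :=
  ∀ (x : M) (u v : TangentSpace (𝓡 n) x), covDerivEnd nabla A x u v = covDerivEnd nabla A x v u

/-- The structure is `(ε)`-para Sasakian:
`(∇_u φ) v = -g(φu, φv) ξ - ε η(v) φ²u`, where `nabla` is the Levi-Civita connection of `g`. -/
def IsEpsParaSasakian (s : EpsAlmostParacontactMetricStructure n M)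
    (nabla : CovariantDerivative (𝓡 n) (EuclideanSpace ℝ (Fin n))
      (TangentSpace (𝓡 n) : M → Type _)) : Prop :=
  ∀ (x : M) (u v : TangentSpace (𝓡 n) x),
    covDerivEnd nabla s.φ x u v =
      -(s.g.val x (s.φ x u) (s.φ x v)) • s.ξ x - (s.ε * s.η x v) • s.φ x (s.φ x u)

/-- `V` is the gradient of `f` with respect to `g`: `g(V, u) = df(u)`. -/
def IsGradient (g : PseudoRiemannianMetric n M) (f : M → ℝ)
    (V : ∀ y : M, TangentSpace (𝓡 n) y) : Prop :=
  ∀ (x : M) (u : TangentSpace (𝓡 n) x), g.val x (V x) u = mvfderiv (𝓡 n) f x u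

/-- `(ξ, lam, mu)`, with constants `lam` and `mu`, is a gradient `η`-Ricci soliton with potential
function `f`: `ξ = grad f` and `Hess f + S + lam g + mu η ⊗ η = 0`, where
`Hess f (u, v) = g(∇_u (grad f), v)`. -/
structure IsGradientEtaRicciSoliton (s : EpsAlmostParacontactMetricStructure n M)
    (nabla : CovariantDerivative (𝓡 n) (EuclideanSpace ℝ (Fin n))
      (TangentSpace (𝓡 n) : M → Type _)) (f : M → ℝ) (lam mu : ℝ) : Prop where
  smooth : ContMDiff (𝓡 n) 𝓘(ℝ, ℝ) ∞ f
  gradient : IsGradient s.g f s.ξ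
  soliton : ∀ (x : M) (u v : TangentSpace (𝓡 n) x),
    s.g.val x (nabla s.ξ x u) v + ricci nabla x u v + lam * s.g.val x u v +
      mu * (s.η x u * s.η x v) = 0

end Geometry

open scoped Topology

/-! ### Smoothness of sections and the bracket as a commutator of derivations -/

section Geometry

variable {n : ℕ} {M : Type*} [TopologicalSpace M]
  [ChartedSpace (EuclideanSpace ℝ (Fin n)) M]

/-! Differentiating `φ ξ = 0` and `g(ξ, ξ) = ε` yields `∇ξ = εφ`, whence `R(X, Y)ξ = η(X)Y - η(Y)X`
and `S(·, ξ) = (1 - n)η`. The soliton equation at `(ξ, ξ)` then ties `lam` to `mu`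
(`soliton_constants`), and as a whole it gives `Q = -εφ - lam I - ε mu η ⊗ ξ`. The Codazzi identity
for the pair `(u, ξ)` collapses to `mu φ = φ²` (`smul_φ_eq`). As `φ³ = φ` and `φ ≠ 0`, this forces
`mu² = 1`.

The Ricci tensor is built from local extensions of vectors, so inserting the field `ξ` requires
`R(X, Y)Z` to be tensorial in `Z`. This comes from skew-symmetry of `R(X, Y)` and nondegeneracy of
`g`; skew-symmetry rests on `[X, Y]h = XYh - YXh`, extracted from the Jacobi identity. -/

theorem Filter.EventuallyEq.mvfderiv_eq {h k : M → ℝ} {x : M} (hk : h =ᶠ[𝓝 x] k) :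
    mvfderiv (𝓡 n) h x = mvfderiv (𝓡 n) k x := by
  ext u
  simp only [mvfderiv, hk.mfderiv_eq]
  rfl

variable [IsManifold (𝓡 n) ∞ M]

theorem VectorFieldCMDiffAt.vectorFieldMDiffAt {Y : ∀ y : M, TangentSpace (𝓡 n) y} {x : M}
    (hY : VectorFieldCMDiffAt Y x) : VectorFieldMDiffAt Y x :=
  ContMDiffAt.mdifferentiableAt hY (by simp)

theorem VectorFieldCMDiffAt.eventually_vectorFieldMDiffAt
    {Y : ∀ y : M, TangentSpace (𝓡 n) y} {x : M} (hY : VectorFieldCMDiffAt Y x) :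
    ∀ᶠ y in 𝓝 x, VectorFieldMDiffAt Y y := by
  have : IsManifold (𝓡 n) 1 M := IsManifold.of_le (n := ∞) (by simp)
  have h1 := (contMDiffAt_iff_contMDiffAt_nhds (n := 1) (by simp)).1
    (ContMDiffAt.of_le hY (by simp))
  exact h1.mono fun y hy ↦ hy.mdifferentiableAt (by simp)

theorem PseudoRiemannianMetric.contMDiffAt_apply (g : PseudoRiemannianMetric n M)
    {Y Z : ∀ y : M, TangentSpace (𝓡 n) y} {x : M}
    (hY : VectorFieldCMDiffAt Y x) (hZ : VectorFieldCMDiffAt Z x) :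
    ContMDiffAt (𝓡 n) 𝓘(ℝ, ℝ) ∞ (fun y ↦ g.val y (Y y) (Z y)) x := by
  have := ContMDiffAt.clm_bundle_apply₂ (F₃ := ℝ) (E₃ := fun _ : M ↦ ℝ) (b := fun y : M ↦ y)
    (g.contMDiff x) hY hZ
  exact (contMDiffAt_section _).1 this

theorem PseudoRiemannianMetric.mdifferentiableAt_apply (g : PseudoRiemannianMetric n M)
    {Y Z : ∀ y : M, TangentSpace (𝓡 n) y} {x : M}
    (hY : VectorFieldMDiffAt Y x) (hZ : VectorFieldMDiffAt Z x) :
    MDifferentiableAt (𝓡 n) 𝓘(ℝ, ℝ) (fun y ↦ g.val y (Y y) (Z y)) x := by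
  have := MDifferentiableAt.clm_bundle_apply₂ (F₃ := ℝ) (E₃ := fun _ : M ↦ ℝ) (b := fun y : M ↦ y)
    ((g.contMDiff x).mdifferentiableAt (by simp)) hY hZ
  exact (mdifferentiableAt_section ..).1 this

/-- The Lie bracket acts on functions as the commutator of derivations. -/
theorem mvfderiv_mlieBracket_smul {X Y W : ∀ y : M, TangentSpace (𝓡 n) y} {h : M → ℝ} {x : M}
    (hX : VectorFieldCMDiffAt X x) (hY : VectorFieldCMDiffAt Y x) (hW : VectorFieldCMDiffAt W x)
    (hh : ContMDiffAt (𝓡 n) 𝓘(ℝ, ℝ) ∞ h x)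
    (hhX : MDifferentiableAt (𝓡 n) 𝓘(ℝ, ℝ) (fun y ↦ mvfderiv (𝓡 n) h y (X y)) x)
    (hhY : MDifferentiableAt (𝓡 n) 𝓘(ℝ, ℝ) (fun y ↦ mvfderiv (𝓡 n) h y (Y y)) x) :
    mvfderiv (𝓡 n) h x (VectorField.mlieBracket (𝓡 n) X Y x) • W x =
      (mvfderiv (𝓡 n) (fun y ↦ mvfderiv (𝓡 n) h y (Y y)) x (X x) -
        mvfderiv (𝓡 n) (fun y ↦ mvfderiv (𝓡 n) h y (X y)) x (Y x)) • W x := by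
  have : IsManifold (𝓡 n) 1 M := IsManifold.of_le (n := ∞) (by simp)
  have : IsManifold (𝓡 n) (minSmoothness ℝ 3) M :=
    IsManifold.of_le (n := ∞) (by simpa using WithTop.coe_le_coe.2 (le_top : (3 : ℕ∞) ≤ ⊤))
  have : IsManifold (𝓡 n) (((2 : ℕ∞) : ℕ∞ω) + 1) M :=
    IsManifold.of_le (n := ∞) (by norm_cast)
  have two_le' : (2 : ℕ∞ω) ≤ ∞ := WithTop.coe_le_coe.2 (le_top : (2 : ℕ∞) ≤ ⊤)
  have two_le : minSmoothness ℝ 2 ≤ ∞ := by simpa using two_le'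
  have hhW : VectorFieldCMDiffAt (h • W) x := ContMDiffAt.smul_section hh hW
  have hhd : MDifferentiableAt (𝓡 n) 𝓘(ℝ, ℝ) h x := hh.mdifferentiableAt (by simp)
  have hhd' : ∀ᶠ y in 𝓝 x, MDifferentiableAt (𝓡 n) 𝓘(ℝ, ℝ) h y :=
    ((contMDiffAt_iff_contMDiffAt_nhds (n := 1) (by simp)).1 (hh.of_le (by simp))).mono
      fun y hy ↦ hy.mdifferentiableAt (by simp)
  have bracket : ∀ {V : ∀ y : M, TangentSpace (𝓡 n) y}, VectorFieldCMDiffAt V x →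
      VectorFieldMDiffAt (VectorField.mlieBracket (𝓡 n) V W) x := fun {V} hV ↦
    (ContMDiffAt.mlieBracket_vectorField (m := 1) (n := 2) (ContMDiffAt.of_le hV two_le')
      (ContMDiffAt.of_le hW two_le') (by simp; norm_num)).mdifferentiableAt (by simp)
  -- Leibniz rule twice. The middle terms are symmetric under exchanging `U` and `V`, so they drop
  -- out of the Jacobi identity.
  have expand : ∀ {U V : ∀ y : M, TangentSpace (𝓡 n) y}, VectorFieldCMDiffAt V x →
      MDifferentiableAt (𝓡 n) 𝓘(ℝ, ℝ) (fun y ↦ mvfderiv (𝓡 n) h y (V y)) x →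
      VectorField.mlieBracket (𝓡 n) U (VectorField.mlieBracket (𝓡 n) V (h • W)) x =
        mvfderiv (𝓡 n) (fun y ↦ mvfderiv (𝓡 n) h y (V y)) x (U x) • W x +
        mvfderiv (𝓡 n) h x (V x) • VectorField.mlieBracket (𝓡 n) U W x +
        (mvfderiv (𝓡 n) h x (U x) • VectorField.mlieBracket (𝓡 n) V W x +
        h x • VectorField.mlieBracket (𝓡 n) U (VectorField.mlieBracket (𝓡 n) V W) x) := by
    intro U V hV hhV
    have e : VectorField.mlieBracket (𝓡 n) V (h • W) =ᶠ[𝓝 x]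
        (fun y ↦ mvfderiv (𝓡 n) h y (V y)) • W + h • VectorField.mlieBracket (𝓡 n) V W := by
      filter_upwards [hhd', hW.eventually_vectorFieldMDiffAt] with y hy hWy
      simp [VectorField.mlieBracket_smul_right hy hWy]
      rfl
    rw [Filter.EventuallyEq.mlieBracket_vectorField_eq (Filter.EventuallyEq.refl _ U) e,
      VectorField.mlieBracket_add_right
        (MDifferentiableAt.smul_section hhV hW.vectorFieldMDiffAt)
        (MDifferentiableAt.smul_section hhd (bracket hV)),
      VectorField.mlieBracket_smul_right hhV hW.vectorFieldMDiffAt,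
      VectorField.mlieBracket_smul_right hhd (bracket hV)]
  -- Subtracting `h` times Jacobi for `W` from Jacobi for `hW` leaves only second derivatives of `h`
  -- and `[X, Y]h`, all multiplying `W x`.
  have J := VectorField.leibniz_identity_mlieBracket_apply (I := 𝓡 n)
    (ContMDiffAt.of_le hX two_le) (ContMDiffAt.of_le hY two_le) (ContMDiffAt.of_le hW two_le)
  have J' := VectorField.leibniz_identity_mlieBracket_apply (I := 𝓡 n)
    (ContMDiffAt.of_le hX two_le) (ContMDiffAt.of_le hY two_le) (ContMDiffAt.of_le hhW two_le)
  rw [expand hY hhY, expand hX hhX,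
    VectorField.mlieBracket_smul_right hhd hW.vectorFieldMDiffAt, J] at J'
  rw [sub_smul]
  linear_combination (norm := module) (-1 : ℝ) • J'

end Geometry

/-! ### Curvature of the Levi-Civita connection -/

section Connection

variable {n : ℕ} {M : Type*} [TopologicalSpace M]
  [ChartedSpace (EuclideanSpace ℝ (Fin n)) M] [IsManifold (𝓡 n) ∞ M]
  {g : PseudoRiemannianMetric n M}
  {nabla : CovariantDerivative (𝓡 n) (EuclideanSpace ℝ (Fin n))
    (TangentSpace (𝓡 n) : M → Type _)}

theorem vectorFieldCMDiffAt_extend {x : M} (u : TangentSpace (𝓡 n) x) :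
    VectorFieldCMDiffAt (FiberBundle.extend (EuclideanSpace ℝ (Fin n)) u) x :=
  FiberBundle.contMDiffAt_extend _ _ u

theorem IsLeviCivita.vectorFieldCMDiffAt_apply (hnabla : IsLeviCivita g nabla)
    {V Z : ∀ y : M, TangentSpace (𝓡 n) y} {x : M}
    (hV : VectorFieldCMDiffAt V x) (hZ : VectorFieldCMDiffAt Z x) :
    VectorFieldCMDiffAt (fun y ↦ nabla Z y (V y)) x :=
  ContMDiffAt.clm_bundle_apply (hnabla.smooth x Z hZ) hV

/-- Needed on a neighbourhood, not just at `x`, because the function is differentiated again. -/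
theorem IsLeviCivita.mvfderiv_apply_eventuallyEq (hnabla : IsLeviCivita g nabla)
    (V : ∀ y : M, TangentSpace (𝓡 n) y) {Z W : ∀ y : M, TangentSpace (𝓡 n) y} {x : M}
    (hZ : VectorFieldCMDiffAt Z x) (hW : VectorFieldCMDiffAt W x) :
    (fun y ↦ mvfderiv (𝓡 n) (fun z ↦ g.val z (Z z) (W z)) y (V y)) =ᶠ[𝓝 x]
      (fun y ↦ g.val y (nabla Z y (V y)) (W y)) + fun y ↦ g.val y (Z y) (nabla W y (V y)) := by
  filter_upwards [hZ.eventually_vectorFieldMDiffAt, hW.eventually_vectorFieldMDiffAt]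
    with y hZy hWy
  exact hnabla.metric y Z W hZy hWy (V y)

theorem IsLeviCivita.mdifferentiableAt_mvfderiv_apply (hnabla : IsLeviCivita g nabla)
    {V Z W : ∀ y : M, TangentSpace (𝓡 n) y} {x : M} (hV : VectorFieldCMDiffAt V x)
    (hZ : VectorFieldCMDiffAt Z x) (hW : VectorFieldCMDiffAt W x) :
    MDifferentiableAt (𝓡 n) 𝓘(ℝ, ℝ)
      (fun y ↦ mvfderiv (𝓡 n) (fun z ↦ g.val z (Z z) (W z)) y (V y)) x := by
  refine MDifferentiableAt.congr_of_eventuallyEq ?_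
    (hnabla.mvfderiv_apply_eventuallyEq V hZ hW)
  exact (g.mdifferentiableAt_apply (hnabla.vectorFieldCMDiffAt_apply hV hZ).vectorFieldMDiffAt
    hW.vectorFieldMDiffAt).add (g.mdifferentiableAt_apply hZ.vectorFieldMDiffAt
    (hnabla.vectorFieldCMDiffAt_apply hV hW).vectorFieldMDiffAt)

theorem IsLeviCivita.mvfderiv_mvfderiv_apply (hnabla : IsLeviCivita g nabla)
    {V Z W : ∀ y : M, TangentSpace (𝓡 n) y} {x : M} (hV : VectorFieldCMDiffAt V x)
    (hZ : VectorFieldCMDiffAt Z x) (hW : VectorFieldCMDiffAt W x) (u : TangentSpace (𝓡 n) x) :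
    mvfderiv (𝓡 n) (fun y ↦ mvfderiv (𝓡 n) (fun z ↦ g.val z (Z z) (W z)) y (V y)) x u =
      g.val x (nabla (fun y ↦ nabla Z y (V y)) x u) (W x) +
        g.val x (nabla Z x (V x)) (nabla W x u) +
      (g.val x (nabla Z x u) (nabla W x (V x)) +
        g.val x (Z x) (nabla (fun y ↦ nabla W y (V y)) x u)) := by
  have hVZ := (hnabla.vectorFieldCMDiffAt_apply hV hZ).vectorFieldMDiffAt
  have hVW := (hnabla.vectorFieldCMDiffAt_apply hV hW).vectorFieldMDiffAt
  rw [(hnabla.mvfderiv_apply_eventuallyEq V hZ hW).mvfderiv_eq,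
    mvfderiv_add (g.mdifferentiableAt_apply hVZ hW.vectorFieldMDiffAt)
      (g.mdifferentiableAt_apply hZ.vectorFieldMDiffAt hVW), add_apply,
    hnabla.metric x _ _ hVZ hW.vectorFieldMDiffAt u,
    hnabla.metric x _ _ hZ.vectorFieldMDiffAt hVW u]

/-- The curvature endomorphism `R(X, Y)` of the Levi-Civita connection is skew-symmetric. -/
theorem IsLeviCivita.curvature_skew (hnabla : IsLeviCivita g nabla)
    {X Y Z W : ∀ y : M, TangentSpace (𝓡 n) y} {x : M}
    (hX : VectorFieldCMDiffAt X x) (hY : VectorFieldCMDiffAt Y x)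
    (hZ : VectorFieldCMDiffAt Z x) (hW : VectorFieldCMDiffAt W x) :
    g.val x (curvature nabla X Y Z x) (W x) + g.val x (Z x) (curvature nabla X Y W x) = 0 := by
  -- The bracket identity carries a factor `U x` that must be nonzero to be cancelled; `Z` or `W`
  -- serves unless both vanish at `x`, when the claim is trivial.
  by_cases h0 : Z x = 0 ∧ W x = 0
  · simp [h0.1, h0.2]
  obtain ⟨U, hU, hU0⟩ : ∃ U : ∀ y : M, TangentSpace (𝓡 n) y,
      VectorFieldCMDiffAt U x ∧ U x ≠ 0 := by
    by_cases hZ0 : Z x = 0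
    · exact ⟨W, hW, fun h ↦ h0 ⟨hZ0, h⟩⟩
    · exact ⟨Z, hZ, hZ0⟩
  have key := smul_left_injective ℝ hU0 (mvfderiv_mlieBracket_smul hX hY hU
    (g.contMDiffAt_apply hZ hW) (hnabla.mdifferentiableAt_mvfderiv_apply hX hZ hW)
    (hnabla.mdifferentiableAt_mvfderiv_apply hY hZ hW))
  -- The cross terms `g(∇_X Z, ∇_Y W)` and `g(∇_Y Z, ∇_X W)` cancel on antisymmetrising in `X, Y`.
  rw [hnabla.metric x _ _ hZ.vectorFieldMDiffAt hW.vectorFieldMDiffAt,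
    hnabla.mvfderiv_mvfderiv_apply hX hZ hW, hnabla.mvfderiv_mvfderiv_apply hY hZ hW] at key
  simp only [curvature, map_sub, sub_apply]
  linear_combination -key

/-- The value at `x` of `R(X, Y) Z` depends on `Z` only through `Z x`. -/
theorem IsLeviCivita.curvature_congr (hnabla : IsLeviCivita g nabla)
    {X Y Z Z' : ∀ y : M, TangentSpace (𝓡 n) y} {x : M}
    (hX : VectorFieldCMDiffAt X x) (hY : VectorFieldCMDiffAt Y x)
    (hZ : VectorFieldCMDiffAt Z x) (hZ' : VectorFieldCMDiffAt Z' x) (h : Z x = Z' x) :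
    curvature nabla X Y Z x = curvature nabla X Y Z' x := by
  -- Skew-symmetry moves the curvature onto the test field, leaving only the value of `Z` at `x`.
  refine sub_eq_zero.1 (g.nondegenerate x _ fun w ↦ ?_)
  have e := hnabla.curvature_skew hX hY hZ (vectorFieldCMDiffAt_extend w)
  have e' := hnabla.curvature_skew hX hY hZ' (vectorFieldCMDiffAt_extend w)
  rw [h] at e
  simp only [FiberBundle.extend_apply_self] at e e'
  rw [map_sub, sub_apply]
  linear_combination e - e'

end Connection

/-! ### Para Sasakian identities and the soliton -/

section ParaSasakian

variable {n : ℕ} {M : Type*} [TopologicalSpace M]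
  [ChartedSpace (EuclideanSpace ℝ (Fin n)) M] [IsManifold (𝓡 n) ∞ M]
  (s : EpsAlmostParacontactMetricStructure n M)
  {nabla : CovariantDerivative (𝓡 n) (EuclideanSpace ℝ (Fin n))
    (TangentSpace (𝓡 n) : M → Type _)}

namespace EpsAlmostParacontactMetricStructure

theorem ε_mul_ε : s.ε * s.ε = 1 := by
  rcases s.ε_eq with h | h <;> simp [h]

theorem g_ξ (x : M) (u : TangentSpace (𝓡 n) x) : s.g.val x u (s.ξ x) = s.ε * s.η x u := by
  have h := s.g_φ_φ x u (s.ξ x)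
  rw [s.φ_ξ, s.η_ξ, map_zero] at h
  linarith

theorem ξ_g (x : M) (u : TangentSpace (𝓡 n) x) : s.g.val x (s.ξ x) u = s.ε * s.η x u := by
  rw [s.g.symm, s.g_ξ]

theorem φ_cube (x : M) (u : TangentSpace (𝓡 n) x) : s.φ x (s.φ x (s.φ x u)) = s.φ x u := by
  rw [s.φ_sq, s.η_φ, zero_smul, sub_zero]

theorem vectorFieldMDiffAt_φ {V : ∀ y : M, TangentSpace (𝓡 n) y} {x : M}
    (hV : VectorFieldMDiffAt V x) : VectorFieldMDiffAt (fun y ↦ s.φ y (V y)) x :=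
  MDifferentiableAt.clm_bundle_apply ((s.contMDiff_φ x).mdifferentiableAt (by simp)) hV

theorem vectorFieldCMDiffAt_ξ (x : M) : VectorFieldCMDiffAt s.ξ x := s.contMDiff_ξ x

theorem covDerivEnd_φ_apply {V : ∀ y : M, TangentSpace (𝓡 n) y} {x : M}
    (hV : VectorFieldMDiffAt V x) (u : TangentSpace (𝓡 n) x) :
    nabla (fun y ↦ s.φ y (V y)) x u =
      covDerivEnd nabla s.φ x u (V x) + s.φ x (nabla V x u) := by
  rw [covDerivEnd_apply nabla s.φ x ((s.contMDiff_φ x).mdifferentiableAt (by simp)) u V hV,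
    sub_add_cancel]

end EpsAlmostParacontactMetricStructure

variable {s}

/-- Differentiating `φ ξ = 0` determines `∇_u ξ` up to a multiple of `ξ`; constancy of `g(ξ, ξ)`
makes that multiple zero. -/
theorem IsEpsParaSasakian.nabla_ξ (hs : IsEpsParaSasakian s nabla)
    (hnabla : IsLeviCivita s.g nabla) (x : M) (u : TangentSpace (𝓡 n) x) :
    nabla s.ξ x u = s.ε • s.φ x u := by
  have hξ := (s.vectorFieldCMDiffAt_ξ x).vectorFieldMDiffAt
  have h1 := s.covDerivEnd_φ_apply (nabla := nabla) hξ u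
  have e0 : (fun y ↦ s.φ y (s.ξ y)) = 0 := funext fun y ↦ s.φ_ξ y
  rw [e0, nabla.zero, hs x u (s.ξ x), s.φ_ξ, map_zero, s.η_ξ] at h1
  have h2 : s.φ x (nabla s.ξ x u) = s.ε • s.φ x (s.φ x u) := by
    rw [Pi.zero_apply, zero_apply, neg_zero, zero_smul, zero_sub, mul_one] at h1
    exact (neg_add_eq_zero.1 h1.symm).symm
  have h3 : s.η x (nabla s.ξ x u) = 0 := by
    have e1 : (fun y ↦ s.g.val y (s.ξ y) (s.ξ y)) = fun _ ↦ s.ε :=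
      funext fun y ↦ by rw [s.g_ξ, s.η_ξ, mul_one]
    have h := hnabla.metric x s.ξ s.ξ hξ hξ u
    rw [e1, mvfderiv_const, s.g_ξ, s.ξ_g, zero_apply] at h
    have h' : s.ε * s.η x (nabla s.ξ x u) = 0 := by linarith
    exact (mul_eq_zero.1 h').resolve_left (left_ne_zero_of_mul_eq_one s.ε_mul_ε)
  have h4 := congrArg (s.φ x) h2
  rw [s.φ_sq, h3, zero_smul, sub_zero, map_smul, s.φ_cube] at h4
  exact h4

/-- `R(X, Y) ξ = η(X) Y - η(Y) X`. -/
theorem IsEpsParaSasakian.curvature_ξ (hs : IsEpsParaSasakian s nabla)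
    (hnabla : IsLeviCivita s.g nabla) {X Y : ∀ y : M, TangentSpace (𝓡 n) y} {x : M}
    (hX : VectorFieldMDiffAt X x) (hY : VectorFieldMDiffAt Y x) :
    curvature nabla X Y s.ξ x = s.η x (X x) • Y x - s.η x (Y x) • X x := by
  have e : ∀ {V : ∀ y : M, TangentSpace (𝓡 n) y}, VectorFieldMDiffAt V x →
      ∀ u, nabla (fun y ↦ nabla s.ξ y (V y)) x u =
        s.ε • (covDerivEnd nabla s.φ x u (V x) + s.φ x (nabla V x u)) := by
    intro V hV u
    have e1 : (fun y ↦ nabla s.ξ y (V y)) = s.ε • fun y ↦ s.φ y (V y) :=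
      funext fun y ↦ hs.nabla_ξ hnabla y (V y)
    rw [e1, nabla.isCovariantDerivativeOnUniv.smul_const _ (s.vectorFieldMDiffAt_φ hV),
      smul_apply, s.covDerivEnd_φ_apply hV]
  -- Under `φ` the terms `∇_X Y - ∇_Y X - [X, Y]` cancel by vanishing torsion; the `g(φX, φY) ξ`
  -- terms cancel by symmetry.
  rw [curvature, e hX, e hY, hs.nabla_ξ hnabla, ← hnabla.torsion_free x X Y hX hY, hs, hs,
    s.g.symm x (s.φ x (Y x)), s.φ_sq, s.φ_sq, map_sub]
  linear_combination (norm := module)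
    s.ε_mul_ε • (s.η x (X x) • Y x - s.η x (Y x) • X x)

theorem IsEpsParaSasakian.ricci_ξ (hs : IsEpsParaSasakian s nabla)
    (hnabla : IsLeviCivita s.g nabla) (x : M) (u : TangentSpace (𝓡 n) x) :
    ricci nabla x u (s.ξ x) = (1 - n) * s.η x u := by
  -- The extension of the vector `s.ξ x` is exchanged for the field `ξ` itself.
  have e (v : TangentSpace (𝓡 n) x) :
      curvatureTensor nabla x v u (s.ξ x) = s.η x v • u - s.η x u • v := by
    rw [curvatureTensor, hnabla.curvature_congr (vectorFieldCMDiffAt_extend v)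
      (vectorFieldCMDiffAt_extend u) (vectorFieldCMDiffAt_extend (s.ξ x))
      (s.vectorFieldCMDiffAt_ξ x) (by simp),
      hs.curvature_ξ hnabla (vectorFieldCMDiffAt_extend v).vectorFieldMDiffAt
        (vectorFieldCMDiffAt_extend u).vectorFieldMDiffAt]
    simp
  have hu : s.η x u = ∑ i, s.η x (tangentBasis x i) * (tangentBasis x).coord i u := by
    conv_lhs => rw [← (tangentBasis x).sum_repr u, map_sum]
    exact Finset.sum_congr rfl fun i _ ↦ by simp [mul_comm]
  simp only [ricci, e, map_sub, map_smul, smul_eq_mul, Finset.sum_sub_distrib]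
  rw [← hu]
  simp
  ring

variable {f : M → ℝ} {lam mu : ℝ}
  {Q : ∀ x : M, TangentSpace (𝓡 n) x →L[ℝ] TangentSpace (𝓡 n) x}

/-- At `(ξ, ξ)` the Hessian vanishes because `φ ξ = 0`, leaving `1 - n + ε lam + mu = 0`. -/
theorem IsEpsParaSasakian.soliton_constants (hs : IsEpsParaSasakian s nabla)
    (hnabla : IsLeviCivita s.g nabla) (hsol : IsGradientEtaRicciSoliton s nabla f lam mu)
    (x : M) : lam = s.ε * (n - 1 - mu) := by
  have h := hsol.soliton x (s.ξ x) (s.ξ x)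
  rw [hs.nabla_ξ hnabla, s.φ_ξ, hs.ricci_ξ hnabla, s.g_ξ, s.g_ξ, smul_zero, map_zero, s.η_ξ] at h
  linear_combination s.ε * h - lam * s.ε_mul_ε

/-- The last coefficient is written with `g(u, ξ) = ε η(u)`, so that metric compatibility can
differentiate it. -/
theorem IsEpsParaSasakian.ricciOperator_apply (hs : IsEpsParaSasakian s nabla)
    (hnabla : IsLeviCivita s.g nabla) (hsol : IsGradientEtaRicciSoliton s nabla f lam mu)
    (hQ : IsRicciOperator s.g nabla Q) (x : M) (u : TangentSpace (𝓡 n) x) :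
    Q x u = (-s.ε) • s.φ x u + (-lam) • u + (-mu) • s.g.val x u (s.ξ x) • s.ξ x := by
  refine sub_eq_zero.1 (s.g.nondegenerate x _ fun w ↦ ?_)
  have h := hsol.soliton x u w
  rw [hs.nabla_ξ hnabla, ← hQ] at h
  simp only [map_sub, map_add, map_smul, sub_apply, add_apply, smul_apply, smul_eq_mul,
    s.g_ξ, s.ξ_g] at h ⊢
  linear_combination h + mu * s.η x u * s.η x w * s.ε_mul_ε

theorem IsEpsParaSasakian.covDerivEnd_ricciOperator (hs : IsEpsParaSasakian s nabla)
    (hnabla : IsLeviCivita s.g nabla) (hsol : IsGradientEtaRicciSoliton s nabla f lam mu)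
    (hQ : IsRicciOperator s.g nabla Q) (x : M) (u v : TangentSpace (𝓡 n) x) :
    covDerivEnd nabla Q x u v = (-s.ε) • covDerivEnd nabla s.φ x u v
      - mu • ((s.ε * s.g.val x (s.φ x u) v) • s.ξ x + s.η x v • s.φ x u) := by
  have : IsManifold (𝓡 n) 1 M := IsManifold.of_le (n := ∞) (by simp)
  rw [covDerivEnd]
  set V : ∀ y : M, TangentSpace (𝓡 n) y :=
    FiberBundle.extend (EuclideanSpace ℝ (Fin n)) v with hVdef
  have hVx : V x = v := by simp [hVdef]
  have hV : VectorFieldMDiffAt V x := (vectorFieldCMDiffAt_extend v).vectorFieldMDiffAt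
  have hξ := (s.vectorFieldCMDiffAt_ξ x).vectorFieldMDiffAt
  have hφV := s.vectorFieldMDiffAt_φ hV
  have hg := s.g.mdifferentiableAt_apply hV hξ
  have hgξ : VectorFieldMDiffAt ((fun y ↦ s.g.val y (V y) (s.ξ y)) • s.ξ) x :=
    MDifferentiableAt.smul_section hg hξ
  -- The formula for `Q` holds at every point, so the section `QV` can be differentiated term by
  -- term.
  have e : (fun y ↦ Q y (V y)) = ((-s.ε) • fun y ↦ s.φ y (V y)) + (-lam) • V +
      (-mu) • ((fun y ↦ s.g.val y (V y) (s.ξ y)) • s.ξ) :=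
    funext fun y ↦ hs.ricciOperator_apply hnabla hsol hQ y (V y)
  have hc := nabla.isCovariantDerivativeOnUniv
  rw [e, hc.add (mdifferentiableAt_add_section (MDifferentiableAt.smul_const_section hφV)
      (MDifferentiableAt.smul_const_section hV)) (MDifferentiableAt.smul_const_section hgξ),
    hc.add (MDifferentiableAt.smul_const_section hφV) (MDifferentiableAt.smul_const_section hV),
    hc.smul_const _ hφV, hc.smul_const _ hV, hc.smul_const _ hgξ, hc.leibniz hξ hg,
    hs.ricciOperator_apply hnabla hsol hQ]
  simp only [add_apply, smul_apply, ContinuousLinearMap.smulRight_apply]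
  rw [s.covDerivEnd_φ_apply hV, hnabla.metric x V s.ξ hV hξ u, hs.nabla_ξ hnabla, hVx,
    map_smul, s.g_ξ x v, s.g.symm x v, smul_eq_mul]
  linear_combination (norm := module) -(s.ε_mul_ε • (mu * s.η x v) • s.φ x u)

/-- With `v = ξ`, `(∇_u Q)ξ = φ²u - mu φu`, whereas `(∇_ξ Q)u = 0` since every term contains `φ ξ`.
-/
theorem IsEpsParaSasakian.smul_φ_eq (hs : IsEpsParaSasakian s nabla)
    (hnabla : IsLeviCivita s.g nabla) (hsol : IsGradientEtaRicciSoliton s nabla f lam mu)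
    (hQ : IsRicciOperator s.g nabla Q) (hCodazzi : IsCodazzi nabla Q)
    (x : M) (u : TangentSpace (𝓡 n) x) : mu • s.φ x u = s.φ x (s.φ x u) := by
  have h := hCodazzi x u (s.ξ x)
  rw [hs.covDerivEnd_ricciOperator hnabla hsol hQ, hs.covDerivEnd_ricciOperator hnabla hsol hQ,
    hs x, hs x, s.φ_ξ, s.η_ξ, s.g_ξ, s.η_φ, map_zero, map_zero, map_zero, zero_apply,
    zero_apply] at h
  linear_combination (norm := module) -h + s.ε_mul_ε • s.φ x (s.φ x u)

end ParaSasakian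

/-! ### Determination of the constants -/

theorem mainTheorem1 (n : ℕ) (hn : 2 < n) (M : Type*) [TopologicalSpace M] [Nonempty M]
    [ChartedSpace (EuclideanSpace ℝ (Fin n)) M] [IsManifold (𝓡 n) ∞ M]
    (s : EpsAlmostParacontactMetricStructure n M)
    (nabla : CovariantDerivative (𝓡 n) (EuclideanSpace ℝ (Fin n))
      (TangentSpace (𝓡 n) : M → Type _))
    (hnabla : IsLeviCivita s.g nabla)
    (hs : IsEpsParaSasakian s nabla)
    (f : M → ℝ) (lam mu : ℝ)
    (hsol : IsGradientEtaRicciSoliton s nabla f lam mu)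
    (Q : ∀ x : M, TangentSpace (𝓡 n) x →L[ℝ] TangentSpace (𝓡 n) x)
    (hQ : IsRicciOperator s.g nabla Q)
    (hCodazzi : IsCodazzi nabla Q) :
    (∀ (x : M) (u : TangentSpace (𝓡 n) x), mu • s.φ x u = s.φ x (s.φ x u)) ∧
    mu ^ 2 = 1 ∧
    ((lam = s.ε * n ∧ mu = -1) ∨ (lam = s.ε * (n - 2) ∧ mu = 1)) ∧
    (s.ε = 1 → 0 < lam) ∧
    (s.ε = -1 → lam < 0) := by
  obtain ⟨x⟩ := ‹Nonempty M›
  have hφ := hs.smul_φ_eq hnabla hsol hQ hCodazzi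
  have hlam := hs.soliton_constants hnabla hsol x
  have hn' : (2 : ℝ) < n := by exact_mod_cast hn
  -- If `φ` vanished at `x`, then `φ² = I - η ⊗ ξ` would make `ξ` span the tangent space.
  obtain ⟨u, hu⟩ : ∃ u : TangentSpace (𝓡 n) x, s.φ x u ≠ 0 := by
    by_contra! h
    have hspan : ∀ u : TangentSpace (𝓡 n) x, ∃ c : ℝ, c • s.ξ x = u := fun u ↦
      ⟨s.η x u, by have := s.φ_sq x u; rw [h] at this; exact (sub_eq_zero.1 this.symm).symm⟩
    have hle := finrank_le_one (s.ξ x) hspan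
    have : Module.finrank ℝ (TangentSpace (𝓡 n) x) = n := finrank_euclideanSpace_fin
    omega
  have hmu : mu ^ 2 = 1 := by
    -- At `φu` the relation reads `mu φ²u = φ³u = φu`, and `φ²u = mu φu`.
    have h := hφ x (s.φ x u)
    rw [s.φ_cube, ← hφ x u, smul_smul] at h
    refine smul_left_injective ℝ hu ?_
    simpa [sq] using h
  have hcases : (lam = s.ε * n ∧ mu = -1) ∨ (lam = s.ε * (n - 2) ∧ mu = 1) := by
    rcases (sq_eq_sq_iff_eq_or_eq_neg.1 (hmu.trans (one_pow 2).symm)) with rfl | rfl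
    · exact Or.inr ⟨by rw [hlam]; ring, rfl⟩
    · exact Or.inl ⟨by rw [hlam]; ring, rfl⟩
  -- Since `n > 2`, both values of `lam` have the sign of `ε`.
  refine ⟨hφ, hmu, hcases, fun h ↦ ?_, fun h ↦ ?_⟩ <;>
    rcases hcases with ⟨hl, -⟩ | ⟨hl, -⟩ <;> rw [hl, h] <;> linarith
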